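/- Let $d\ge 2$ and $m\ge 1$ be integers with $dm\ge 4$, and put $\rho=12.88$ if $4\le dm\le 10$ and $\rho=2$ if $dm\ge 11$. Let $H\ge 1$ be a real number with $$\log H\ \ge\ dm(\log(dm))^2\,e^{dm(\log(dm))^2}.$$ Then there is a real number $\omega=\omega(m,H)$ (depending only on $d$, $m$ and $H$) with $$\omega\ <\ m+\frac{\rho\,(m^2+3m+2)\log(dm)}{\log\log H}$$ such that for every imaginary quadratic field $\mathbb I\subset\mathbb C$ with ring of integers $\mathbb Z_{\mathbb I}$ the bound $$\left|\lambda_0+\lambda_1e^{d}+\lambda_2e^{2d}+\dots+\lambda_me^{md}\right|\ >\ \frac{1}{H^{\omega}}$$ holds for all $(\lambda_0,\lambda_1,\dots,\lambda_m)\in\mathbb Z_{\mathbb I}^{m+1}\setminus\{0\}$ with $\max_{1\le i\le m}|\lambda_i|\le H$ (there is no restriction on the size of $\lambda_0$). In particular, it holds for all rational integers $\lambda_0,\dots,\lambda_m$, not all zero, with $\max_{1\le i\le m}|\lambda_i|\le H$. -/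

import Mathlib

open scoped NumberField

/-- A subfield `K` of `ℂ` is an imaginary quadratic field: it has degree two over `ℚ` and is not
contained in `ℝ`. -/
def IsImaginaryQuadraticField (K : IntermediateField ℚ ℂ) : Prop :=
  Module.finrank ℚ K = 2 ∧ ∃ z ∈ K, z.im ≠ 0

/-- The constant `ρ`, as a function of the degree `M ≥ 4`: it is `12.88`, and `2` once `M ≥ 11`. -/
noncomputable def rho (M : ℕ) : ℝ := if 11 ≤ M then 2 else 12.88

/-! With F = f + f' + f'' + …, the quantity e^x F(0) − F(x) is controlled by f on [0, x]. Put M =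
dm. Hermite's polynomials f_k vanish to order l at 0, d, …, md, but to order l − 1 at kd, so F_k(dj)
= (l − 1)! A_kj with integers A_kj. If l is a multiple of a prime p > M, then A is diagonal mod p
with nonzero diagonal entries, hence nonsingular (`exists_matrix`).

Some Σ_j A_kj λ_j is therefore a nonzero imaginary quadratic integer, of absolute value at least 1.
It differs from A_k0 Λ, where Λ is the linear form, by less than 1/2 once (l − 1)! exceeds 2mH e^M
M^((m+1)l); so |A_k0 Λ| > 1/2 (`half_lt_mul_norm_sum_exp`). The least multiple l of p passing a test
sufficient for this is at most ρ log H / log log H + p, which turns the bound |A_k0| ≤ ((m+1)l − 1)!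
e^M / (l − 1)! into a power of H (`exists_order`). -/

open Polynomial in
/-- The values of a polynomial and of the sum of its derivatives at two points are related by the
exponential function, up to an error controlled by the size of the polynomial in between. -/
theorem abs_exp_mul_eval_sumIDeriv_sub_le (f : ℝ[X]) {x B : ℝ} (hx : 0 ≤ x)
    (hB : ∀ t ∈ Set.Icc 0 x, |f.eval t| ≤ B) :
    |Real.exp x * f.sumIDeriv.eval 0 - f.sumIDeriv.eval x| ≤ Real.exp x * (B * x) := by
  -- Since F = f + F', the derivative of e^(−t) F(t) telescopes to −e^(−t) f(t).
  have hder : ∀ t ∈ Set.Icc 0 x, HasDerivWithinAt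
      (fun t => Real.exp (-t) * f.sumIDeriv.eval t) (-(Real.exp (-t) * f.eval t))
      (Set.Icc 0 x) t := by
    intro t _
    have h₁ := (hasDerivAt_neg t).exp
    have h₂ := h₁.mul ((sumIDeriv f).hasDerivAt t)
    refine HasDerivAt.hasDerivWithinAt (h₂.congr_deriv ?_)
    nth_rw 1 [sumIDeriv_eq_self_add f]
    simp only [eval_add]
    ring
  have hbound : ∀ t ∈ Set.Ico 0 x, ‖-(Real.exp (-t) * f.eval t)‖ ≤ B := by
    intro t ht
    rw [norm_neg, norm_mul, Real.norm_eq_abs, Real.norm_eq_abs, Real.abs_exp]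
    have h₁ : Real.exp (-t) ≤ 1 := Real.exp_le_one_iff.2 (by linarith [ht.1])
    exact (mul_le_of_le_one_left (abs_nonneg _) h₁).trans (hB t ⟨ht.1, ht.2.le⟩)
  have h := norm_image_sub_le_of_norm_deriv_le_segment' hder hbound x ⟨hx, le_rfl⟩
  rw [Real.norm_eq_abs, abs_sub_comm, sub_zero, neg_zero, Real.exp_zero, one_mul] at h
  have e : Real.exp x * f.sumIDeriv.eval 0 - f.sumIDeriv.eval x =
      Real.exp x * (f.sumIDeriv.eval 0 - Real.exp (-x) * f.sumIDeriv.eval x) := by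
    rw [mul_sub, ← mul_assoc, ← Real.exp_add]; simp
  rw [e, abs_mul, Real.abs_exp]
  gcongr

/-! ### Coefficient majorants -/

namespace Polynomial

theorem abs_coeff_mul_le {f g F G : ℤ[X]} (hf : ∀ i, |f.coeff i| ≤ F.coeff i)
    (hg : ∀ i, |g.coeff i| ≤ G.coeff i) (i : ℕ) : |(f * g).coeff i| ≤ (F * G).coeff i := by
  rw [coeff_mul, coeff_mul]
  refine (Finset.abs_sum_le_sum_abs _ _).trans (Finset.sum_le_sum fun a _ => ?_)
  rw [abs_mul]
  exact mul_le_mul (hf _) (hg _) (abs_nonneg _) ((abs_nonneg _).trans (hf _))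

theorem abs_coeff_pow_le {f F : ℤ[X]} (hf : ∀ i, |f.coeff i| ≤ F.coeff i) (n i : ℕ) :
    |(f ^ n).coeff i| ≤ (F ^ n).coeff i := by
  induction n generalizing i with
  | zero => simp only [pow_zero, coeff_one]; split_ifs <;> simp
  | succ n ih => rw [pow_succ, pow_succ]; exact abs_coeff_mul_le ih hf i

theorem abs_coeff_prod_le {ι : Type*} (s : Finset ι) {f F : ι → ℤ[X]}
    (hf : ∀ k i, |(f k).coeff i| ≤ (F k).coeff i) (i : ℕ) :
    |(∏ k ∈ s, f k).coeff i| ≤ (∏ k ∈ s, F k).coeff i := by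
  classical
  induction s using Finset.induction_on generalizing i with
  | empty => simp only [Finset.prod_empty, coeff_one]; split_ifs <;> simp
  | insert a s ha ih =>
    rw [Finset.prod_insert ha, Finset.prod_insert ha]; exact abs_coeff_mul_le (hf a) ih i

theorem eval_zero_sumIDeriv {f : ℤ[X]} {N : ℕ} (hN : f.natDegree ≤ N) :
    f.sumIDeriv.eval 0 = ∑ i ∈ Finset.range (N + 1), (i.factorial : ℤ) * f.coeff i := by
  rw [sumIDeriv_apply_of_le hN, eval_finsetSum]
  refine Finset.sum_congr rfl fun i _ => ?_
  rw [← coeff_zero_eq_eval_zero, coeff_iterate_derivative, zero_add, Nat.descFactorial_self,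
    nsmul_eq_mul]

/-- A product of linear factors of total degree `N` whose roots are at most `M`: the alternating
sum of derivatives at zero is at most `N! e ^ M`. -/
theorem abs_eval_zero_sumIDeriv_prod_le {ι : Type*} (s : Finset ι) (a : ι → ℤ) (e : ι → ℕ) (M : ℕ)
    (ha : ∀ k, |a k| ≤ M) :
    |(((∏ k ∈ s, (X - C (a k)) ^ e k).sumIDeriv.eval 0 : ℤ) : ℝ)| ≤
      (∑ k ∈ s, e k).factorial * Real.exp M := by
  set N := ∑ k ∈ s, e k with hNdef
  set f : ℤ[X] := ∏ k ∈ s, (X - C (a k)) ^ e k with hf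
  have hlin : ∀ k i, |(X - C (a k) : ℤ[X]).coeff i| ≤ (X + C (M : ℤ)).coeff i := by
    intro k i
    rw [coeff_sub, coeff_add, coeff_X, coeff_C]
    rcases i with _ | _ | i <;> simp [ha k]
  have hcoeff : ∀ i, |f.coeff i| ≤ ((X + C (M : ℤ)) ^ N : ℤ[X]).coeff i := by
    intro i
    rw [hNdef, ← Finset.prod_pow_eq_pow_sum]
    exact abs_coeff_prod_le s (fun k i => abs_coeff_pow_le (hlin k) _ i) i
  have hdeg : f.natDegree ≤ N := by
    rw [hf, natDegree_prod_of_monic _ _ fun k _ => (monic_X_sub_C _).pow _]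
    refine Finset.sum_le_sum fun k _ => ?_
    rw [natDegree_pow, natDegree_X_sub_C, mul_one]
  rw [eval_zero_sumIDeriv hdeg]
  push_cast
  refine (Finset.abs_sum_le_sum_abs _ _).trans ?_
  -- The majorant (X + M)^N turns the sum into N! times a partial sum of the series for e^M.
  have hterm : ∀ i ∈ Finset.range (N + 1), |((i.factorial : ℝ) * (f.coeff i : ℝ))| ≤
      N.factorial * ((M : ℝ) ^ (N - i) / (N - i).factorial) := by
    intro i hi
    have hi' : i ≤ N := Nat.lt_succ_iff.1 (Finset.mem_range.1 hi)
    rw [abs_mul, Nat.abs_cast]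
    have h₁ : |(f.coeff i : ℝ)| ≤ (M : ℝ) ^ (N - i) * (N.choose i) := by
      have := hcoeff i
      rw [coeff_X_add_C_pow] at this
      exact_mod_cast this
    refine (mul_le_mul_of_nonneg_left h₁ (Nat.cast_nonneg _)).trans_eq ?_
    rw [← Nat.choose_mul_factorial_mul_factorial hi']
    have : ((N - i).factorial : ℝ) ≠ 0 := by exact_mod_cast Nat.factorial_ne_zero _
    push_cast
    field_simp
  refine (Finset.sum_le_sum hterm).trans ?_
  rw [← Finset.mul_sum]
  refine mul_le_mul_of_nonneg_left ?_ (Nat.cast_nonneg _)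
  rw [Finset.sum_flip (fun i => (M : ℝ) ^ i / i.factorial)]
  exact Real.sum_le_exp_of_nonneg (Nat.cast_nonneg _) _

end Polynomial

/-! ### Norms in imaginary quadratic fields -/

theorem Algebra.norm_eq_mul_of_finrank_eq_two {L : Type*} [Field L] [NumberField L]
    (h2 : Module.finrank ℚ L = 2) {σ τ : L →ₐ[ℚ] ℂ} (h : σ ≠ τ) (x : L) :
    algebraMap ℚ ℂ (Algebra.norm ℚ x) = σ x * τ x := by
  classical
  have huniv : (Finset.univ : Finset (L →ₐ[ℚ] ℂ)) = {σ, τ} := by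
    symm
    apply Finset.eq_univ_of_card
    rw [Finset.card_pair h, AlgHom.card, h2]
  rw [Algebra.norm_eq_prod_embeddings ℚ ℂ x, huniv, Finset.prod_pair h]

/-- A nonzero algebraic integer of an imaginary quadratic field has absolute value at least one. -/
theorem IsImaginaryQuadraticField.one_le_norm {K : IntermediateField ℚ ℂ}
    (hK : IsImaginaryQuadraticField K) (x : 𝓞 K) (hx : x ≠ 0) : 1 ≤ ‖((x : K) : ℂ)‖ := by
  obtain ⟨h2, z, hz, hzim⟩ := hK
  have : FiniteDimensional ℚ K := FiniteDimensional.of_finrank_pos (by omega)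
  have : NumberField K := ⟨⟩
  -- Conjugation is the second embedding, so |x|² is the norm of x, a nonzero integer.
  let c : K →ₐ[ℚ] ℂ := (Complex.conjAe.restrictScalars ℚ).toAlgHom.comp K.val
  have hc : K.val ≠ c := by
    intro h
    have := DFunLike.congr_fun h ⟨z, hz⟩
    have h3 : z = (starRingEnd ℂ) z := this
    exact hzim (Complex.conj_eq_iff_im.1 h3.symm)
  have hn := Algebra.norm_eq_mul_of_finrank_eq_two h2 hc (x : K)
  have hn2 : ‖((Algebra.norm ℚ (x : K) : ℚ) : ℂ)‖ = ‖((x : K) : ℂ)‖ ^ 2 := by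
    have h4 : ((Algebra.norm ℚ (x : K) : ℚ) : ℂ) =
      ((x : K) : ℂ) * (starRingEnd ℂ) ((x : K) : ℂ) := hn
    rw [h4, norm_mul, RCLike.norm_conj, sq]
  have hz : Algebra.norm ℤ x ≠ 0 := Algebra.norm_ne_zero_iff.2 hx
  have hn3 : (Algebra.norm ℚ (x : K) : ℚ) = ((Algebra.norm ℤ x : ℤ) : ℚ) :=
    (Algebra.coe_norm_int x).symm
  rw [hn3] at hn2
  have h5 : (1 : ℝ) ≤ ‖(((Algebra.norm ℤ x : ℤ) : ℚ) : ℂ)‖ := by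
    have h6 := Int.one_le_abs hz
    rw [Rat.cast_intCast, Complex.norm_intCast]
    exact_mod_cast h6
  rw [hn2] at h5
  exact (one_le_sq_iff₀ (norm_nonneg _)).1 h5

/-! ### Hermite's approximations -/

open Polynomial in
/-- The auxiliary polynomials of Hermite: the nodes `0, d, …, md` are zeros of order `l`, except
that the order at `kd` is `l - 1`. -/
noncomputable def hermitePoly (d m l : ℕ) (k : Fin (m + 1)) : ℤ[X] :=
  ∏ i : Fin (m + 1), (X - C ((d * i : ℕ) : ℤ)) ^ (if i = k then l - 1 else l)

namespace hermitePoly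

open Polynomial

theorem sum_exponents {m l : ℕ} (hl : 0 < l) (k : Fin (m + 1)) :
    ∑ i : Fin (m + 1), (if i = k then l - 1 else l) = (m + 1) * l - 1 := by
  rw [← Finset.add_sum_erase _ _ (Finset.mem_univ k), if_pos rfl,
    Finset.sum_congr rfl (g := fun _ => l) fun i hi => if_neg (Finset.ne_of_mem_erase hi),
    Finset.sum_const, Finset.card_erase_of_mem (Finset.mem_univ k), Finset.card_univ,
    Fintype.card_fin, smul_eq_mul, Nat.add_sub_cancel, add_mul, one_mul]
  omega

theorem eq_mul (d m l : ℕ) (k j : Fin (m + 1)) :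
    hermitePoly d m l k = (X - C ((d * j : ℕ) : ℤ)) ^ (if j = k then l - 1 else l) *
      ∏ i ∈ Finset.univ.erase j, (X - C ((d * i : ℕ) : ℤ)) ^ (if i = k then l - 1 else l) :=
  (Finset.mul_prod_erase _ _ (Finset.mem_univ j)).symm

/-- At a zero of order l only derivatives of order at least l survive, and these contribute
multiples of l!. -/
theorem exists_eval_of_ne {d m l : ℕ} (hl : 0 < l) {k j : Fin (m + 1)} (h : j ≠ k) :
    ∃ a : ℤ, (hermitePoly d m l k).sumIDeriv.eval ((d * j : ℕ) : ℤ) =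
      (l - 1).factorial * (l * a) := by
  obtain ⟨g, -, hg⟩ := aeval_sumIDeriv ℤ (hermitePoly d m l k) l
  refine ⟨g.eval ((d * j : ℕ) : ℤ), ?_⟩
  have h₁ := hg ((d * j : ℕ) : ℤ) (by
    rw [eq_mul d m l k j, if_neg h, Algebra.algebraMap_self, map_id]
    exact dvd_mul_right _ _)
  rw [coe_aeval_eq_eval, nsmul_eq_mul, ← Nat.mul_factorial_pred hl.ne'] at h₁
  rw [h₁]
  push_cast
  ring

/-- The derivative of order l − 1 contributes (l − 1)! ∏ (dk − di)^l over i ≠ k, the later ones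
multiples of l!. Each dk − di is nonzero and smaller than p in absolute value. -/
theorem exists_eval_self {d m l p : ℕ} (hd : 0 < d) (hp : p.Prime) (hl : 0 < l) (hpl : p ∣ l)
    (hpm : d * m < p) (k : Fin (m + 1)) :
    ∃ a : ℤ, (hermitePoly d m l k).sumIDeriv.eval ((d * k : ℕ) : ℤ) =
      (l - 1).factorial * a ∧ ¬ (p : ℤ) ∣ a := by
  obtain ⟨g, -, hg⟩ := eval_sumIDeriv_of_pos (hermitePoly d m l k) hl
  have h₁ := hg ((d * k : ℕ) : ℤ) (by rw [eq_mul d m l k k, if_pos rfl])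
  rw [nsmul_eq_mul, nsmul_eq_mul, ← Nat.mul_factorial_pred hl.ne', Nat.cast_mul l,
    mul_comm (l : ℤ), mul_assoc, ← mul_add] at h₁
  refine ⟨_, h₁, fun hdvd => ?_⟩
  have h₂ := (dvd_add_left (dvd_mul_of_dvd_left (Int.natCast_dvd_natCast.2 hpl) _)).1 hdvd
  rw [eval_prod, (Nat.prime_iff_prime_int.1 hp).dvd_finsetProd_iff] at h₂
  obtain ⟨i, hi, h₃⟩ := h₂
  rw [eval_pow, eval_sub, eval_X, eval_C] at h₃
  have h₄ := (Nat.prime_iff_prime_int.1 hp).dvd_of_dvd_pow h₃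
  have hik : (i : ℕ) ≠ k := fun h => Finset.ne_of_mem_erase hi (Fin.ext h)
  have hi' : d * (i : ℕ) ≤ d * m := Nat.mul_le_mul_left _ (by omega)
  have hk' : d * (k : ℕ) ≤ d * m := Nat.mul_le_mul_left _ (by omega)
  have h₅ : ((d * k : ℕ) : ℤ) - ((d * i : ℕ) : ℤ) = 0 :=
    Int.eq_zero_of_abs_lt_dvd h₄ (by rw [abs_lt]; omega)
  exact hik (Nat.eq_of_mul_eq_mul_left hd (by omega))

/-- The values at the nodes, divided by `(l - 1)!`, form a nonsingular integer matrix. -/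
theorem exists_matrix {d m l p : ℕ} (hd : 0 < d) (hp : p.Prime) (hl : 0 < l) (hpl : p ∣ l)
    (hpm : d * m < p) :
    ∃ A : Matrix (Fin (m + 1)) (Fin (m + 1)) ℤ, A.det ≠ 0 ∧ ∀ k j : Fin (m + 1),
      (hermitePoly d m l k).sumIDeriv.eval ((d * j : ℕ) : ℤ) = (l - 1).factorial * A k j := by
  have H : ∀ k j : Fin (m + 1), ∃ a : ℤ,
      (hermitePoly d m l k).sumIDeriv.eval ((d * j : ℕ) : ℤ) = (l - 1).factorial * a ∧
      (j ≠ k → (p : ℤ) ∣ a) ∧ (j = k → ¬ (p : ℤ) ∣ a) := by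
    intro k j
    by_cases h : j = k
    · subst h
      obtain ⟨a, h₁, h₂⟩ := exists_eval_self hd hp hl hpl hpm j
      exact ⟨a, h₁, fun h => (h rfl).elim, fun _ => h₂⟩
    · obtain ⟨a, h₁⟩ := exists_eval_of_ne (d := d) hl h
      exact ⟨l * a, h₁, fun _ => dvd_mul_of_dvd_left (Int.natCast_dvd_natCast.2 hpl) _,
        fun h' => (h h').elim⟩
  choose A hA hne heq using H
  refine ⟨Matrix.of A, fun hdet => ?_, hA⟩
  have : Fact p.Prime := ⟨hp⟩
  have hmap : (Matrix.of A).map (Int.castRingHom (ZMod p)) =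
      Matrix.diagonal fun k => ((A k k : ℤ) : ZMod p) := by
    ext k j
    by_cases h : k = j
    · subst h; simp
    · rw [Matrix.diagonal_apply_ne _ h, Matrix.map_apply]
      exact (ZMod.intCast_zmod_eq_zero_iff_dvd _ _).2 (hne k j (Ne.symm h))
  have h₁ := congrArg (Int.castRingHom (ZMod p)) hdet
  rw [RingHom.map_det, RingHom.mapMatrix_apply, hmap, Matrix.det_diagonal, map_zero,
    Finset.prod_eq_zero_iff] at h₁
  obtain ⟨k, -, hk⟩ := h₁
  exact heq k k rfl ((ZMod.intCast_zmod_eq_zero_iff_dvd _ _).1 hk)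

theorem abs_eval_zero_le {d m l : ℕ} (hl : 0 < l) (k : Fin (m + 1)) :
    |(((hermitePoly d m l k).sumIDeriv.eval 0 : ℤ) : ℝ)| ≤
      ((m + 1) * l - 1).factorial * Real.exp (d * m : ℕ) := by
  rw [← sum_exponents hl k]
  refine abs_eval_zero_sumIDeriv_prod_le _ _ _ _ fun i => ?_
  rw [Nat.abs_cast]
  exact_mod_cast Nat.mul_le_mul_left d (by omega : (i : ℕ) ≤ m)

theorem abs_eval_map_le {d m l : ℕ} (hl : 0 < l) (k : Fin (m + 1)) {t : ℝ}
    (ht : t ∈ Set.Icc (0 : ℝ) (d * m : ℕ)) :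
    |((hermitePoly d m l k).map (Int.castRingHom ℝ)).eval t| ≤
      ((d * m : ℕ) : ℝ) ^ ((m + 1) * l - 1) := by
  rw [← sum_exponents hl k, ← Finset.prod_pow_eq_pow_sum, hermitePoly, Polynomial.map_prod,
    eval_prod, Finset.abs_prod]
  refine Finset.prod_le_prod (fun _ _ => abs_nonneg _) fun i _ => ?_
  rw [Polynomial.map_pow, eval_pow, abs_pow]
  refine pow_le_pow_left₀ (abs_nonneg _) ?_ _
  have hi : ((d * i : ℕ) : ℝ) ≤ (d * m : ℕ) :=
    Nat.cast_le.2 (Nat.mul_le_mul_left d (by omega : (i : ℕ) ≤ m))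
  have hi0 : (0 : ℝ) ≤ (d * i : ℕ) := Nat.cast_nonneg _
  rw [Polynomial.map_sub, map_X, map_C, eval_sub, eval_X, eval_C, eq_intCast, Int.cast_natCast]
  rw [abs_le]
  constructor <;> linarith [ht.1, ht.2]

theorem abs_exp_mul_sub_le {d m l : ℕ} (hl : 0 < l) (k j : Fin (m + 1)) :
    |Real.exp (d * j : ℕ) * (((hermitePoly d m l k).sumIDeriv.eval 0 : ℤ) : ℝ) -
        (((hermitePoly d m l k).sumIDeriv.eval ((d * j : ℕ) : ℤ) : ℤ) : ℝ)| ≤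
      Real.exp (d * m : ℕ) * ((d * m : ℕ) : ℝ) ^ ((m + 1) * l) := by
  have hj : ((d * j : ℕ) : ℝ) ≤ (d * m : ℕ) :=
    Nat.cast_le.2 (Nat.mul_le_mul_left d (by omega : (j : ℕ) ≤ m))
  -- The polynomial has degree (m + 1)l − 1; the interval length supplies one more factor dm.
  have hN : (m + 1) * l = ((m + 1) * l - 1) + 1 := by
    have : 0 < (m + 1) * l := by positivity
    omega
  have h := abs_exp_mul_eval_sumIDeriv_sub_le
    ((hermitePoly d m l k).map (Int.castRingHom ℝ)) (x := (d * j : ℕ)) (Nat.cast_nonneg _)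
    fun t ht => abs_eval_map_le hl k ⟨ht.1, ht.2.trans hj⟩
  have e₁ := eval_intCast_map (Int.castRingHom ℝ) (sumIDeriv (hermitePoly d m l k)) 0
  have e₂ := eval_intCast_map (Int.castRingHom ℝ) (sumIDeriv (hermitePoly d m l k))
    ((d * j : ℕ) : ℤ)
  rw [Int.cast_zero] at e₁
  rw [Int.cast_natCast] at e₂
  rw [sumIDeriv_map, e₁, e₂] at h
  refine h.trans ?_
  rw [hN, pow_succ, Nat.add_sub_cancel]
  gcongr

end hermitePoly

/-- A lower bound for linear forms in `1, e ^ d, …, e ^ (md)` from Hermite's approximations of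
order `l`. -/
theorem half_lt_mul_norm_sum_exp {d m l p : ℕ} (hd : 0 < d) (hp : p.Prime) (hl : 0 < l)
    (hpl : p ∣ l) (hpm : d * m < p) {H : ℝ} (hH : 0 ≤ H)
    (hsmall : 2 * (m * H * (Real.exp (d * m : ℕ) * ((d * m : ℕ) : ℝ) ^ ((m + 1) * l))) <
      (l - 1).factorial)
    {K : IntermediateField ℚ ℂ} (hK : IsImaginaryQuadraticField K)
    (lam : Fin (m + 1) → 𝓞 K) (hlam : lam ≠ 0)
    (hle : ∀ i : Fin (m + 1), 1 ≤ (i : ℕ) → ‖((lam i : K) : ℂ)‖ ≤ H) :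
    1 / 2 < ((m + 1) * l - 1).factorial / (l - 1).factorial * Real.exp (d * m : ℕ) *
      ‖∑ i : Fin (m + 1), ((lam i : K) : ℂ) * Complex.exp 1 ^ (d * (i : ℕ))‖ := by
  obtain ⟨A, hdet, hA⟩ := hermitePoly.exists_matrix hd hp hl hpl hpm
  set F : ℝ := ((l - 1).factorial : ℝ) with hF
  have hF0 : 0 < F := by rw [hF]; exact_mod_cast Nat.factorial_pos _
  obtain ⟨k, hk⟩ : ∃ k, ∑ j, (A k j : 𝓞 K) * lam j ≠ 0 := by
    by_contra! hall
    refine hlam (Matrix.eq_zero_of_mulVec_eq_zero (M := A.map (Int.castRingHom (𝓞 K))) ?_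
      (funext fun k => ?_))
    · rw [← RingHom.mapMatrix_apply, ← RingHom.map_det]
      exact Int.cast_ne_zero.2 hdet
    · exact hall k
  have hone := hK.one_le_norm _ hk
  have hcast : (((∑ j, (A k j : 𝓞 K) * lam j : 𝓞 K) : K) : ℂ) =
      ∑ j, (A k j : ℂ) * ((lam j : K) : ℂ) := by
    have h := map_sum (K.val.toRingHom.comp (algebraMap (𝓞 K) K))
      (fun j => (A k j : 𝓞 K) * lam j) Finset.univ
    refine h.trans (Finset.sum_congr rfl fun j _ => ?_)
    rw [map_mul, map_intCast]
    rfl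
  rw [hcast] at hone
  have hsplit : (A k 0 : ℂ) * ∑ i : Fin (m + 1), ((lam i : K) : ℂ) * Complex.exp 1 ^ (d * (i : ℕ)) =
      ∑ j, (A k j : ℂ) * ((lam j : K) : ℂ) +
      ∑ j : Fin (m + 1), ((lam j : K) : ℂ) * ((Real.exp (d * j : ℕ) * A k 0 - A k j : ℝ) : ℂ) := by
    rw [Finset.mul_sum, ← Finset.sum_add_distrib]
    refine Finset.sum_congr rfl fun j _ => ?_
    rw [← Complex.exp_nat_mul]
    push_cast
    rw [mul_one]
    ring
  have h0 : ∀ k, (((hermitePoly d m l k).sumIDeriv.eval 0 : ℤ) : ℝ) = F * A k 0 := by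
    intro k
    have h := hA k 0
    rw [Fin.val_zero, mul_zero, Nat.cast_zero] at h
    rw [h, hF]; push_cast; ring
  have herr : ∀ j : Fin (m + 1), |Real.exp (d * j : ℕ) * A k 0 - A k j| ≤
      Real.exp (d * m : ℕ) * ((d * m : ℕ) : ℝ) ^ ((m + 1) * l) / F := by
    intro j
    rw [le_div_iff₀ hF0]
    refine le_trans (le_of_eq ?_) (hermitePoly.abs_exp_mul_sub_le (d := d) hl k j)
    rw [h0, hA, ← abs_of_pos hF0, ← abs_mul, abs_of_pos hF0, hF]
    push_cast
    congr 1; ring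
  set E : ℝ := Real.exp (d * m : ℕ) * ((d * m : ℕ) : ℝ) ^ ((m + 1) * l) with hE
  have hrem : ‖∑ j : Fin (m + 1), ((lam j : K) : ℂ) *
      ((Real.exp (d * j : ℕ) * A k 0 - A k j : ℝ) : ℂ)‖ < 1 / 2 := by
    -- The term j = 0 vanishes identically, which is why λ_0 needs no bound.
    rw [Fin.sum_univ_succ]
    simp only [Fin.val_zero, mul_zero, Nat.cast_zero, Real.exp_zero, one_mul, sub_self,
      Complex.ofReal_zero, zero_add]
    have h₁ : ∀ j ∈ (Finset.univ : Finset (Fin m)), ‖((lam j.succ : K) : ℂ) *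
        ((Real.exp (d * j.succ : ℕ) * A k 0 - A k j.succ : ℝ) : ℂ)‖ ≤ H * (E / F) := by
      intro j _
      rw [norm_mul, Complex.norm_real, Real.norm_eq_abs]
      exact mul_le_mul (hle _ (by simp)) (herr _) (abs_nonneg _) hH
    refine (norm_sum_le_of_le _ h₁).trans_lt ?_
    rw [Finset.sum_const, Finset.card_univ, Fintype.card_fin, nsmul_eq_mul, ← mul_assoc,
      ← mul_div_assoc, div_lt_iff₀ hF0]
    linarith
  have hA0 : ‖(A k 0 : ℂ)‖ ≤ ((m + 1) * l - 1).factorial / F * Real.exp (d * m : ℕ) := by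
    rw [Complex.norm_intCast, div_mul_eq_mul_div, le_div_iff₀ hF0, mul_comm, ← abs_of_pos hF0,
      ← abs_mul, ← h0]
    exact hermitePoly.abs_eval_zero_le hl k
  have hlow : 1 / 2 < ‖(A k 0 : ℂ) *
      ∑ i : Fin (m + 1), ((lam i : K) : ℂ) * Complex.exp 1 ^ (d * (i : ℕ))‖ := by
    rw [hsplit]
    have := norm_sub_le_norm_add (∑ j, (A k j : ℂ) * ((lam j : K) : ℂ))
      (∑ j : Fin (m + 1), ((lam j : K) : ℂ) * ((Real.exp (d * j : ℕ) * A k 0 - A k j : ℝ) : ℂ))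
    linarith
  rw [norm_mul] at hlow
  exact hlow.trans_le (mul_le_mul_of_nonneg_right hA0 (norm_nonneg _))

/-! ### Numerical estimates and the choice of the order -/

theorem eight_mul_pow_three_le_exp {s : ℝ} (hs : 9 ≤ s) : 8 * s ^ 3 ≤ Real.exp s := by
  have h₁ : 2 * s ≤ Real.exp (s / 3) := by
    have h₂ : Real.exp (s / 3) = Real.exp 1 ^ 3 * Real.exp (s / 3 - 3) := by
      rw [← Real.exp_nat_mul, ← Real.exp_add]; congr 1; push_cast; ring
    have h₃ : (2.7 : ℝ) ^ 3 ≤ Real.exp 1 ^ 3 :=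
      pow_le_pow_left₀ (by norm_num) (by linarith [Real.exp_one_gt_d9]) 3
    have h₄ : s / 3 - 2 ≤ Real.exp (s / 3 - 3) := by linarith [Real.add_one_le_exp (s / 3 - 3)]
    rw [h₂]
    refine le_trans ?_ (mul_le_mul h₃ h₄ (by linarith) (by positivity))
    linarith
  calc 8 * s ^ 3 = (2 * s) ^ 3 := by ring
    _ ≤ Real.exp (s / 3) ^ 3 := pow_le_pow_left₀ (by linarith) h₁ 3
    _ = Real.exp s := by rw [← Real.exp_nat_mul]; congr 1; push_cast; ring

theorem two_le_rho (M : ℕ) : 2 ≤ rho M := by unfold rho; split_ifs <;> norm_num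

theorem rho_le (M : ℕ) : rho M ≤ 12.88 := by unfold rho; split_ifs <;> norm_num

theorem log_natCast_gt {M : ℕ} (hM : 4 ≤ M) : 1.386 < Real.log M := by
  have h : Real.log 4 ≤ Real.log M := Real.log_le_log (by norm_num) (by exact_mod_cast hM)
  have h₄ : Real.log 4 = 2 * Real.log 2 := by
    rw [show (4 : ℝ) = 2 ^ 2 by norm_num, Real.log_pow]; norm_num
  linarith [Real.log_two_gt_d9]

/-- At n = ρ e^s / s one has log n ≥ s − log s, so this gives ρ (log n − c log M − 1) ≥ s with slack
0.06. The term c log M is weighed against M (log M)², whence the smaller ρ for larger M. -/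
theorem rho_mul_le {M : ℕ} (hM : 4 ≤ M) {s c : ℝ} (hs9 : 9 ≤ s)
    (hs : M * Real.log M ^ 2 + Real.log M ≤ s) (hc : 2 * c ≤ M + 2) :
    rho M * (Real.log s + c * Real.log M + 1) + 0.06 ≤ (rho M - 1) * s := by
  have hL := log_natCast_gt hM
  -- Tangent to log at 8, with 3 log 2 − 1 < 1.08.
  have hlogs : Real.log s ≤ s / 8 + 1.08 := by
    have h₁ := Real.log_le_sub_one_of_pos (show 0 < s / 8 by linarith)
    rw [Real.log_div (by linarith) (by norm_num), show (8 : ℝ) = 2 ^ 3 by norm_num,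
      Real.log_pow] at h₁
    push_cast at h₁
    linarith [Real.log_two_lt_d9]
  have hM4 : (4 : ℝ) ≤ M := by exact_mod_cast hM
  unfold rho
  split_ifs with h
  · have hM11 : (11 : ℝ) ≤ M := by exact_mod_cast h
    have hL11 : 2.35 ≤ Real.log M := by
      have h₁ : Real.log (8 * (11 / 8)) ≤ Real.log M :=
        Real.log_le_log (by norm_num) (by linarith)
      rw [Real.log_mul (by norm_num) (by norm_num), show (8 : ℝ) = 2 ^ 3 by norm_num,
        Real.log_pow] at h₁
      have h₂ := Real.one_sub_inv_le_log_of_pos (show (0 : ℝ) < 11 / 2 ^ 3 by norm_num)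
      push_cast at h₁
      norm_num at h₁ h₂
      linarith [Real.log_two_gt_d9]
    set L := Real.log M
    have h₁ : 2 * c * L ≤ (M + 2) * L := mul_le_mul_of_nonneg_right hc (by linarith)
    have h₂ : 2.35 * (M * L) ≤ M * L ^ 2 := by
      have := mul_le_mul_of_nonneg_right hL11 (show 0 ≤ M * L by positivity)
      linarith
    have h₃ : 11 * L ≤ M * L := mul_le_mul_of_nonneg_right hM11 (by linarith)
    linarith
  · set L := Real.log M
    have h₁ : 2 * c * L ≤ (M + 2) * L := mul_le_mul_of_nonneg_right hc (by linarith)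
    have h₂ : 1.386 * (M * L) ≤ M * L ^ 2 := by
      have := mul_le_mul_of_nonneg_right hL.le (show 0 ≤ M * L by positivity)
      linarith
    have h₃ : 4 * L ≤ M * L := mul_le_mul_of_nonneg_right hM4 (by linarith)
    linarith

theorem mul_log_add_le {n p : ℝ} (hn : 0 ≤ n) (hp : 0 < p) :
    (n + p) * Real.log (n + p) ≤ n * Real.log n + p + p * Real.log (n + p) := by
  rcases hn.eq_or_lt with rfl | hn
  · simp [hp.le]
  · have h := Real.log_le_sub_one_of_pos (show 0 < (n + p) / n by positivity)
    rw [Real.log_div (by positivity) hn.ne'] at h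
    have h₁ := mul_le_mul_of_nonneg_left h hn.le
    have h₂ : n * ((n + p) / n - 1) = p := by field_simp; ring
    linarith

/-- Numerical constraints on the height: here `s = log log H`. -/
structure HeightBounds (M : ℕ) (s : ℝ) : Prop where
  four_le : 4 ≤ M
  nine_le : 9 ≤ s
  main_le : M * Real.log M ^ 2 + Real.log M ≤ s

namespace HeightBounds

variable {M : ℕ} {s : ℝ}

theorem of_le_log {X : ℝ} (hM : 4 ≤ M)
    (hX : M * Real.log M ^ 2 * Real.exp (M * Real.log M ^ 2) ≤ X) :
    0 < X ∧ HeightBounds M (Real.log X) := by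
  have hL := log_natCast_gt hM
  have hM4 : (4 : ℝ) ≤ M := by exact_mod_cast hM
  have h0 : 0 < M * Real.log M ^ 2 * Real.exp (M * Real.log M ^ 2) := by positivity
  have h := Real.log_le_log h0 hX
  rw [Real.log_mul (by positivity) (Real.exp_pos _).ne', Real.log_exp,
    Real.log_mul (by positivity) (by positivity), Real.log_pow] at h
  have h₁ := Real.log_nonneg (show 1 ≤ Real.log M by linarith)
  push_cast at h
  have hmain : M * Real.log M ^ 2 + Real.log M ≤ Real.log X := by linarith
  refine ⟨h0.trans_le hX, hM, ?_, hmain⟩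
  -- The bound 9 comes from 4 · 1.386² + 1.386 > 9.
  have h₂ : (1.386 : ℝ) ^ 2 ≤ Real.log M ^ 2 := pow_le_pow_left₀ (by norm_num) hL.le 2
  have h₃ := mul_le_mul hM4 h₂ (by norm_num) (by linarith)
  norm_num at h₃
  linarith

theorem mul_log_le (h : HeightBounds M s) : M * Real.log M ≤ 0.73 * s := by
  have hL := log_natCast_gt h.four_le
  have h₁ : 1.386 * (M * Real.log M) ≤ M * Real.log M ^ 2 := by
    have := mul_le_mul_of_nonneg_right hL.le (show 0 ≤ M * Real.log M by positivity)
    linarith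
  linarith [h.main_le, h.nine_le]

theorem natCast_le (h : HeightBounds M s) : M ≤ 0.53 * s := by
  have hL := log_natCast_gt h.four_le
  have h₁ : 1.386 * M ≤ M * Real.log M := by
    have := mul_le_mul_of_nonneg_left hL.le (show (0 : ℝ) ≤ M by positivity)
    linarith
  linarith [h.mul_log_le, h.nine_le]

theorem le_exp_div (h : HeightBounds M s) : 8 * s ^ 2 ≤ Real.exp s / s := by
  have := h.nine_le
  rw [le_div_iff₀ (by linarith)]
  linarith [eight_mul_pow_three_le_exp h.nine_le]

theorem log_add_le (h : HeightBounds M s) :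
    Real.log (rho M * (Real.exp s / s) + 2 * M) ≤ 2 * s := by
  have h9 := h.nine_le
  have h2 := two_le_rho M
  have hpos : 0 < rho M * (Real.exp s / s) := by positivity
  have hexp : 8 * s ^ 2 * s ≤ Real.exp s := by linarith [eight_mul_pow_three_le_exp h9]
  rw [Real.log_le_iff_le_exp (by positivity)]
  have h₁ : rho M * (Real.exp s / s) ≤ 2 * Real.exp s := by
    rw [mul_div_assoc', div_le_iff₀ (by linarith)]
    have := mul_le_mul_of_nonneg_right (rho_le M) (Real.exp_pos s).le
    have := mul_le_mul_of_nonneg_left h9 (Real.exp_pos s).le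
    linarith [Real.exp_pos s]
  have h₂ : s ≤ Real.exp s := by linarith [Real.add_one_le_exp s]
  have h₃ : 4 * Real.exp s ≤ Real.exp (2 * s) := by
    rw [two_mul, Real.exp_add]
    exact mul_le_mul_of_nonneg_right (by linarith [Real.add_one_le_exp s]) (Real.exp_pos s).le
  linarith [h.natCast_le]

/-- By monotonicity the case n = Y = ρ e^s / s decides. There `rho_mul_le` leaves a surplus 0.06 e^s
/ s ≥ 0.48 s², which absorbs 2M, log 2 and log Y. -/
theorem add_lt_mul_log (h : HeightBounds M s) {c n : ℝ} (hc : 2 * c ≤ M + 2)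
    (hn : rho M * (Real.exp s / s) ≤ n) :
    Real.exp s + 2 * M + (c * Real.log M + 1) * n + Real.log 2 + Real.log n < n * Real.log n := by
  have h9 := h.nine_le
  have h2 := two_le_rho M
  have hexp := h.le_exp_div
  have hZ0 : 0 < Real.exp s / s := by positivity
  set Z := Real.exp s / s with hZ
  set Y := rho M * Z with hY
  have hsZ : s * Z = Real.exp s := by rw [hZ]; field_simp
  have hs2 : 9 * s ≤ s ^ 2 := by nlinarith
  have hY1 : 1 ≤ Y := by
    have : 2 * Z ≤ Y := mul_le_mul_of_nonneg_right h2 hZ0.le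
    linarith
  have hlogY : s - Real.log s ≤ Real.log Y := by
    rw [hY, hZ, Real.log_mul (by positivity) (by positivity),
      Real.log_div (by positivity) (by positivity), Real.log_exp]
    linarith [Real.log_nonneg (show 1 ≤ rho M by linarith)]
  have hlogY2 : Real.log Y ≤ 2 * s :=
    (Real.log_le_log (by linarith) (le_add_of_nonneg_right (by positivity))).trans h.log_add_le
  have hkey := rho_mul_le h.four_le h9 h.main_le hc
  set K := c * Real.log M
  have hlog : Real.log Y ≤ Real.log n := Real.log_le_log (by linarith) hn
  have h₁ : 0 ≤ (n - 1) * (Real.log n - Real.log Y) :=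
    mul_nonneg (by linarith) (by linarith)
  have h₂ : s + 0.06 ≤ rho M * (s - Real.log s - K - 1) := by linarith
  have h₃ : 0 ≤ s - Real.log s - K - 1 := by
    by_contra hneg
    have := mul_neg_of_pos_of_neg (show 0 < rho M by linarith) (not_le.1 hneg)
    linarith
  have h₄ : Y * (s - Real.log s - K - 1) ≤ n * (Real.log Y - K - 1) :=
    mul_le_mul hn (by linarith) h₃ (by linarith)
  have h₅ : (s + 0.06) * Z ≤ Y * (s - Real.log s - K - 1) := by
    have := mul_le_mul_of_nonneg_right h₂ hZ0.le
    rw [hY]; linarith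
  linarith [h.natCast_le, Real.log_two_lt_d9]

/-- The choice of the order `l` of the approximations, as a multiple of `p`. -/
theorem exists_order (h : HeightBounds M s) {m p : ℕ} (hm : 1 ≤ m) (hmM : 2 * m ≤ M)
    (hp : 0 < p) (hpM : p ≤ 2 * M) :
    ∃ l : ℕ, p ∣ l ∧ 0 < l ∧
      Real.exp s + 2 * M + ((m + 1) * Real.log M + 1) * l + Real.log 2 + Real.log l <
        l * Real.log l ∧
      M + 1 + m * (l * Real.log l) + m * (l * Real.log (m + 1)) <
        m * Real.exp s + rho M * ((m : ℝ) ^ 2 + 3 * m + 2) * Real.log M * (Real.exp s / s) := by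
  classical
  have h9 := h.nine_le
  have h2 := two_le_rho M
  have hL := log_natCast_gt h.four_le
  have hexp := h.le_exp_div
  have hlog := h.log_add_le
  have hc : 2 * ((m : ℝ) + 1) ≤ M + 2 := by
    have : (2 * m : ℝ) ≤ M := by exact_mod_cast hmM
    linarith
  -- P k ensures that (l − 1)! is large enough for l = pk. For the least such k, the failure at k −
  -- 1 bounds l log l from above.
  let P : ℕ → Prop := fun k =>
    Real.exp s + 2 * M + ((m + 1) * Real.log M + 1) * (p * k : ℕ) + Real.log 2 +
      Real.log (p * k : ℕ) < (p * k : ℕ) * Real.log (p * k : ℕ)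
  have hbig : ∀ k, rho M * (Real.exp s / s) ≤ (p * k : ℕ) → P k := fun k hk =>
    h.add_lt_mul_log hc hk
  have hex : ∃ k, P k := by
    obtain ⟨k, hk⟩ := exists_nat_ge (rho M * (Real.exp s / s))
    exact ⟨k, hbig k (hk.trans (Nat.cast_le.2 (Nat.le_mul_of_pos_left k hp)))⟩
  have hspec : P (Nat.find hex) := Nat.find_spec hex
  have hmin := fun k => Nat.find_min hex (m := k)
  set k := Nat.find hex
  have hZ0 : 0 < Real.exp s / s := by positivity
  obtain ⟨j, hj⟩ : ∃ j, k = j + 1 := by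
    -- At k = 0 the convention log 0 = 0 makes P false.
    refine Nat.exists_eq_succ_of_ne_zero fun h0 => ?_
    rw [h0] at hspec
    simp only [P, mul_zero, Nat.cast_zero, Real.log_zero, add_zero] at hspec
    linarith [Real.exp_pos s, Real.log_two_gt_d9, (Nat.cast_nonneg M : (0 : ℝ) ≤ M)]
  have hPj : ¬ P j := hmin j (by omega)
  have hjY : ((p * j : ℕ) : ℝ) ≤ rho M * (Real.exp s / s) := by
    by_contra hlt
    exact hPj (hbig j (not_le.1 hlt).le)
  refine ⟨p * k, dvd_mul_right _ _, by rw [hj]; positivity, hspec, ?_⟩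
  simp only [P, not_lt] at hPj
  have hl : ((p * k : ℕ) : ℝ) = (p * j : ℕ) + p := by rw [hj]; push_cast; ring
  rw [hl]
  have hp0 : (0 : ℝ) < p := Nat.cast_pos.2 hp
  have hp2 : (p : ℝ) ≤ 2 * M := by exact_mod_cast hpM
  set Z := Real.exp s / s
  set n : ℝ := ((p * j : ℕ) : ℝ) with hn
  have hn0 : 0 ≤ n := Nat.cast_nonneg _
  have hm1 : (1 : ℝ) ≤ m := by exact_mod_cast hm
  have hM4 : (4 : ℝ) ≤ M := by exact_mod_cast h.four_le
  have hloglt : Real.log (n + p) ≤ 2 * s :=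
    (Real.log_le_log (by linarith) (by linarith)).trans hlog
  have hlogn : Real.log n ≤ 2 * s := by
    rcases hn0.eq_or_lt with h0 | h0
    · rw [← h0, Real.log_zero]; linarith
    · exact (Real.log_le_log h0 (by linarith)).trans hloglt
  have hlogm : Real.log (m + 1) ≤ Real.log M := Real.log_le_log (by linarith) (by linarith)
  have hlogm0 : 0 ≤ Real.log (m + 1) := Real.log_nonneg (by linarith)
  have hML := h.mul_log_le
  have hMs := h.natCast_le
  set L := Real.log M
  set Y := rho M * Z with hY
  have h₁ := mul_log_add_le hn0 hp0
  have h₂ : p * Real.log (n + p) ≤ 2 * M * (2 * s) :=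
    (mul_le_mul_of_nonneg_left hloglt hp0.le).trans
      (mul_le_mul_of_nonneg_right hp2 (by linarith))
  have h₃ : ((m + 1) * L + 1) * n ≤ ((m + 1) * L + 1) * Y :=
    mul_le_mul_of_nonneg_left hjY (by positivity)
  have h₄ : (n + p) * Real.log (m + 1) ≤ (Y + 2 * M) * L :=
    mul_le_mul (by linarith) hlogm hlogm0 (by positivity)
  have hMss : M * s ≤ 0.53 * s * s := mul_le_mul_of_nonneg_right hMs (by linarith)
  have hs2 : 9 * s ≤ s * s := mul_le_mul_of_nonneg_right h9 (by linarith)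
  have h₅ : (n + p) * Real.log (n + p) + (n + p) * Real.log (m + 1) ≤
      Real.exp s + ((m + 2) * L + 1) * Y + (4 * M + 1 + 2 * s + 2 * M * (2 * s) + 2 * M * L) := by
    linarith [Real.log_two_lt_d9]
  have hY16 : 16 * s ^ 2 ≤ Y := by
    have : 2 * Z ≤ Y := mul_le_mul_of_nonneg_right h2 hZ0.le
    linarith
  -- The budget (m+1)(m+2)LY equals m((m+2)L + 1)Y + ((m+2)L − m)Y. The last part is at least 0.386
  -- mY because L > 1.386, and it pays for the lower-order terms.
  have h₆ : M + 1 + (4 * M + 1 + 2 * s + 2 * M * (2 * s) + 2 * M * L) < 0.386 * Y := by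
    linarith
  have h₇ := mul_le_mul_of_nonneg_left h₅ (show (0 : ℝ) ≤ m by linarith)
  have h₈ : (m : ℝ) * (M + 1 + (4 * M + 1 + 2 * s + 2 * M * (2 * s) + 2 * M * L)) <
      m * (0.386 * Y) := mul_lt_mul_of_pos_left h₆ (by linarith)
  have h₉ : m * (0.386 * Y) ≤ ((m + 2) * L - m) * Y := by
    rw [← mul_assoc]
    refine mul_le_mul_of_nonneg_right ?_ (by linarith [sq_nonneg s])
    have := mul_le_mul_of_nonneg_left hL.le (show (0 : ℝ) ≤ m + 2 by linarith)
    linarith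
  have h₁₀ : (M : ℝ) + 1 ≤ m * (M + 1) := le_mul_of_one_le_left (by linarith) hm1
  have h₁₁ : rho M * ((m : ℝ) ^ 2 + 3 * m + 2) * L * Z = (m + 1) * (m + 2) * L * Y := by
    rw [hY]; ring
  rw [h₁₁]
  linarith

end HeightBounds

/-! ### Factorial bounds and conclusion -/

/-- A single term of the exponential series gives l^l / l! ≤ e^l. -/
theorem exp_le_factorial_pred {l : ℕ} (hl : 0 < l) :
    Real.exp (l * Real.log l - l - Real.log l) ≤ (l - 1).factorial := by
  have hl0 : (0 : ℝ) < l := Nat.cast_pos.2 hl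
  have h := Real.pow_div_factorial_le_exp (l : ℝ) hl0.le l
  rw [← Nat.mul_factorial_pred hl.ne'] at h
  have hF : (0 : ℝ) < (l - 1).factorial := Nat.cast_pos.2 (Nat.factorial_pos _)
  rw [div_le_iff₀ (by positivity)] at h
  rw [Real.exp_sub, Real.exp_sub, Real.exp_log hl0, Real.exp_nat_mul, Real.exp_log hl0,
    div_le_iff₀ hl0, div_le_iff₀ (Real.exp_pos _)]
  push_cast at h
  linarith

/-- The quotient is a product of ml integers, each at most (m + 1)l. -/
theorem factorial_div_factorial_le {m l : ℕ} (hl : 0 < l) :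
    (((m + 1) * l - 1).factorial : ℝ) / (l - 1).factorial ≤
      Real.exp (m * (l * Real.log l) + m * (l * Real.log (m + 1))) := by
  have hl0 : (0 : ℝ) < l := Nat.cast_pos.2 hl
  have hN : (m + 1) * l - 1 = (l - 1) + m * l := by rw [add_mul, one_mul]; omega
  have h₁ : ((m + 1) * l - 1).factorial ≤ (l - 1).factorial * ((m + 1) * l) ^ (m * l) := by
    rw [hN, ← Nat.factorial_mul_ascFactorial]
    refine Nat.mul_le_mul_left _ ((Nat.ascFactorial_le_pow_add _ _).trans ?_)
    rw [← hN]
    exact Nat.pow_le_pow_left (Nat.sub_le _ _) _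
  have h₂ : Real.exp (m * (l * Real.log l) + m * (l * Real.log (m + 1))) =
      (((m + 1) * l : ℕ) : ℝ) ^ (m * l) := by
    rw [← Real.exp_log (show (0 : ℝ) < (((m + 1) * l : ℕ) : ℝ) by positivity), ← Real.exp_nat_mul]
    push_cast
    rw [Real.log_mul (by positivity) hl0.ne']
    congr 1; ring
  rw [h₂, div_le_iff₀ (Nat.cast_pos.2 (Nat.factorial_pos _)), mul_comm (_ ^ _)]
  exact_mod_cast h₁

theorem mainTheorem6 (d m : ℕ) (hd : 2 ≤ d) (hm : 1 ≤ m) (hdm : 4 ≤ d * m)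
    (H : ℝ) (hH : 1 ≤ H)
    (hlogH : (d * m : ℝ) * Real.log (d * m) ^ 2 * Real.exp (d * m * Real.log (d * m) ^ 2)
      ≤ Real.log H) :
    ∃ ω : ℝ,
      ω < m + rho (d * m) * ((m : ℝ) ^ 2 + 3 * m + 2) * Real.log (d * m)
            / Real.log (Real.log H) ∧
      ∀ K : IntermediateField ℚ ℂ, IsImaginaryQuadraticField K →
        ∀ lam : Fin (m + 1) → 𝓞 K, lam ≠ 0 →
          (∀ i : Fin (m + 1), 1 ≤ (i : ℕ) → ‖((lam i : K) : ℂ)‖ ≤ H) →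
            1 / H ^ ω < ‖∑ i : Fin (m + 1), ((lam i : K) : ℂ) * Complex.exp 1 ^ (d * (i : ℕ))‖ := by
  have hH0 : 0 < H := by linarith
  simp only [← Nat.cast_mul] at hlogH ⊢
  obtain ⟨hX, hb⟩ := HeightBounds.of_le_log hdm hlogH
  -- Bertrand's postulate keeps p ≤ 2M, so rounding l to a multiple of p is cheap.
  obtain ⟨p, hp, hMp, hpM⟩ := Nat.exists_prime_lt_and_le_two_mul (d * m) (by omega)
  obtain ⟨l, hpl, hl, hlow, hup⟩ :=
    hb.exists_order hm (Nat.mul_le_mul_right m hd) hp.pos hpM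
  rw [Real.exp_log hX] at hlow hup
  set X := Real.log H with hXdef
  set M := d * m with hM
  have hM0 : (0 : ℝ) < M := Nat.cast_pos.2 (by omega)
  -- e^W is e times the bound for |A_k0|; the extra factor e > 2 cancels the 1/2.
  set W := M + 1 + m * (l * Real.log l) + m * (l * Real.log (m + 1)) with hW
  refine ⟨W / X, ?_, fun K hK lam hlam hle => ?_⟩
  · rw [div_lt_iff₀ hX, add_mul, div_mul_eq_mul_div, mul_div_assoc]
    exact hup
  have hsmall : 2 * (m * H * (Real.exp (d * m : ℕ) * ((d * m : ℕ) : ℝ) ^ ((m + 1) * l))) <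
      (l - 1).factorial := by
    refine lt_of_lt_of_le ?_ (exp_le_factorial_pred hl)
    have hmM : (m : ℝ) ≤ Real.exp M := by
      have h₁ : (m : ℝ) ≤ M := Nat.cast_le.2 (Nat.le_mul_of_pos_left m (by omega))
      linarith [Real.add_one_le_exp (M : ℝ)]
    have hpow : (M : ℝ) ^ ((m + 1) * l) = Real.exp ((m + 1) * l * Real.log M) := by
      nth_rw 1 [← Real.exp_log hM0]
      rw [← Real.exp_nat_mul]
      push_cast
      rfl
    have hE : Real.exp (Real.log 2 + M + X + M + (m + 1) * l * Real.log M) =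
        2 * (Real.exp M * H * (Real.exp M * (M : ℝ) ^ ((m + 1) * l))) := by
      rw [Real.exp_add, Real.exp_add, Real.exp_add, Real.exp_add, Real.exp_log two_pos, hXdef,
        Real.exp_log hH0, hpow]
      ring
    refine lt_of_le_of_lt (b := 2 * (Real.exp M * H * (Real.exp M * (M : ℝ) ^ ((m + 1) * l))))
      (by gcongr) ?_
    rw [← hE, Real.exp_lt_exp]
    linarith
  have hmain := half_lt_mul_norm_sum_exp (by omega) hp hl hpl hMp hH0.le hsmall hK lam hlam hle
  set Λ := ‖∑ i : Fin (m + 1), ((lam i : K) : ℂ) * Complex.exp 1 ^ (d * (i : ℕ))‖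
  have hpowW : H ^ (W / X) = Real.exp W := by
    rw [Real.rpow_def_of_pos hH0, ← hXdef, mul_div_cancel₀ _ hX.ne']
  rw [hpowW, div_lt_iff₀ (Real.exp_pos _), mul_comm]
  have hWsplit : Real.exp W = Real.exp 1 *
      (Real.exp (m * (l * Real.log l) + m * (l * Real.log (m + 1))) * Real.exp M) := by
    rw [← Real.exp_add, ← Real.exp_add]
    congr 1
    rw [hW]
    ring
  have h₁ : 1 / 2 < Real.exp (m * (l * Real.log l) + m * (l * Real.log (m + 1))) *
      Real.exp M * Λ := by
    refine hmain.trans_le ?_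
    gcongr
    exact factorial_div_factorial_le hl
  rw [hWsplit, mul_assoc]
  have h₂ := mul_lt_mul_of_pos_left h₁ (Real.exp_pos 1)
  linarith [Real.exp_one_gt_d9]
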